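/- For $n\ge 0$ and $q\ge 2$ let $H(n,q)$ be the Hamming graph: its vertices are the words of length $n$ over an alphabet of $q$ letters, and two words are adjacent if and only if they differ in exactly one coordinate. For a vertex $x$ of a graph let $B(x)$ be the set consisting of $x$ and all its neighbours. A $1$-perfect bitrade in a graph $G$ is an ordered pair $(T_0,T_1)$ of disjoint nonempty sets of vertices such that, for every vertex $x$ of $G$, the set $B(x)$ either contains exactly one element of $T_0$ and exactly one element of $T_1$, or contains no element of $T_0\cup T_1$. Its size is $|T_0|+|T_1|$. (a) If $q\ge 2$ and $H(n,q)$ contains a $1$-perfect bitrade, then $n=qm+1$ for some integer $m\ge 0$. (b) Let $m\ge 0$ be an integer. If $q\ge 4$, every $1$-perfect bitrade $(T_0,T_1)$ in $H(qm+1,q)$ satisfies $|T_0|+|T_1|\ge 2^{(q-1)m+1}(q-1)^m$. Every $1$-perfect bitrade $(T_0,T_1)$ in $H(3m+1,3)$ satisfies $|T_0|+|T_1|\ge 2^{m+1}3^m$. (c) For all $q\ge 2$ and $m\ge 0$ there is a $1$-perfect bitrade of size $2(q!)^m$ in $H(qm+1,q)$. (d) Consequently, for every $m\ge 0$, the minimum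 size of a $1$-perfect bitrade is exactly $2\cdot 24^m$ in $H(4m+1,4)$ and exactly $2\cdot 6^m$ in $H(3m+1,3)$. -/

import Mathlib

/-- The Hamming graph `H(n,q)`: the vertices are the words of length `n` over an alphabet with `q`
letters; two words are adjacent iff they differ in exactly one coordinate. -/
def hammingGraph (n q : ℕ) : SimpleGraph (Fin n → Fin q) where
  Adj x y := hammingDist x y = 1
  symm := ⟨fun x y h => by rw [hammingDist_comm]; exact h⟩
  loopless := ⟨fun x h => by simp at h⟩

/-- The closed neighbourhood `B(x) = N(x) ∪ {x}` of a vertex of a graph. -/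
def closedNeighborhood {V : Type*} (G : SimpleGraph V) (x : V) : Set V :=
  G.neighborSet x ∪ {x}

/-- `(T₀, T₁)` is a 1-perfect bitrade in the graph `G`: `T₀` and `T₁` are disjoint and nonempty, and
every `B(x)` either contains exactly one element of `T₀` and exactly one element of `T₁`, or
contains no element of `T₀ ∪ T₁`. -/
structure IsOnePerfectBitrade {V : Type*} (G : SimpleGraph V) (T₀ T₁ : Set V) : Prop where
  disjoint : Disjoint T₀ T₁
  nonempty_left : T₀.Nonempty
  nonempty_right : T₁.Nonempty
  neighborhood : ∀ x : V,
    ((closedNeighborhood G x ∩ T₀).ncard = 1 ∧ (closedNeighborhood G x ∩ T₁).ncard = 1) ∨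
      closedNeighborhood G x ∩ (T₀ ∪ T₁) = ∅

/-- The set of sizes `|T₀| + |T₁|` of the 1-perfect bitrades `(T₀, T₁)` in `H(n,q)`. -/
def bitradeSizes (n q : ℕ) : Set ℕ :=
  {s | ∃ T₀ T₁ : Set (Fin n → Fin q),
    IsOnePerfectBitrade (hammingGraph n q) T₀ T₁ ∧ T₀.ncard + T₁.ncard = s}

/-!
The signed indicator function `f` of a bitrade sums to zero over every closed neighbourhood, so it
is an eigenfunction of `H(n,q)` with eigenvalue `-1`. The eigenvalues of `H(n,q)` are
`n(q-1) - qi` with `0 ≤ i ≤ n`, so `n = qm + 1` and `i = (q-1)m + 1`. The size of the bitrade is the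
size of the support of `f`, and the lower bounds hold for every nonzero eigenfunction of that index.

The support is bounded by induction on the number of coordinates. Since slices of eigenfunctions
need not be eigenfunctions, the induction runs over sums of consecutive eigenspaces, of indices in a
band `[i, j]` (`InBand`). Fixing coordinate `k` of `f` gives `q` slices: their sum stays in
`[i, j]`, their differences lie in `[i-1, j-1]`, and each of them lies in `[i-1, j]`. For `q ≥ 4`
either two disjoint pairs of slices are unequal, and the two differences account for twice the
inductive bound, or all slices but one agree; for `q = 3` the alternative to the latter is that the
three slices are distinct.

With `p = q - 1`, a direction with `p` slices equal to `g` and one equal to `h` is treated as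
follows. If `g = 0` or `h = 0`, the other function lies in `[i, j-1]`. Otherwise
`p |g| + |h|` is at least `(p-1)|g| + |g - h|` and at least `(p-1)|g| + |pg + h|`, where `| |`
counts the support. The first estimate suffices when `i + j ≤ n` (`supportCard_ge_of_add_le`); the
second gives a sharper bound when `i + j ≥ n` for functions that have this shape in every direction
(`IsNearConst.supportCard_ge`). For all other functions some direction falls under the alternative,
which yields `supportCard_ge_of_le_add` and `supportCard_ge_of_le_add_three`.

Small bitrades come from words that list permutations of the alphabet. A word that is not a
permutation but is adjacent to one is adjacent to exactly two of them, of opposite signs. Appending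
to a bitrade all permutations, with the two parts exchanged at the odd ones, therefore gives a
bitrade that is `q!` times as large (`IsOnePerfectBitrade.append`).
-/

/-! ### Slices and supports -/

/-- The function of `n` coordinates obtained from `f` by giving coordinate `k` the value `a`. -/
def hammingSlice {n q : ℕ} (k : Fin (n + 1)) (a : Fin q) (f : (Fin (n + 1) → Fin q) → ℚ) :
    (Fin n → Fin q) → ℚ :=
  fun y => f (Fin.insertNth (α := fun _ => Fin q) k a y)

/-- The number of points at which `f` does not vanish. -/
def supportCard {α : Type*} [Fintype α] (f : α → ℚ) : ℕ :=
  (Finset.univ.filter fun x => f x ≠ 0).card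

theorem hammingSlice_ext {n q : ℕ} (k : Fin (n + 1)) {f g : (Fin (n + 1) → Fin q) → ℚ}
    (h : ∀ a, hammingSlice k a f = hammingSlice k a g) : f = g := by
  funext x
  have h1 := congrFun (h (x k)) (k.removeNth x)
  simpa [hammingSlice] using h1

theorem supportCard_eq_sum_hammingSlice {n q : ℕ} (k : Fin (n + 1))
    (f : (Fin (n + 1) → Fin q) → ℚ) :
    supportCard f = ∑ a, supportCard (hammingSlice k a f) := by
  unfold supportCard
  simp only [Finset.card_filter]
  rw [← (Fin.insertNthEquiv (fun _ => Fin q) k).sum_comp, Fintype.sum_prod_type]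
  rfl

theorem supportCard_sub_le {α : Type*} [Fintype α] (f g : α → ℚ) :
    supportCard (f - g) ≤ supportCard f + supportCard g := by
  classical
  unfold supportCard
  refine le_trans (Finset.card_le_card ?_) (Finset.card_union_le _ _)
  intro x
  simp only [Finset.mem_filter, Finset.mem_union, Finset.mem_univ, true_and, Pi.sub_apply]
  contrapose!
  rintro ⟨h1, h2⟩
  rw [h1, h2, sub_zero]

theorem supportCard_smul {α : Type*} [Fintype α] {r : ℚ} (hr : r ≠ 0) (f : α → ℚ) :
    supportCard (r • f) = supportCard f := by
  simp [supportCard, hr]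

theorem supportCard_add_le {α : Type*} [Fintype α] (f g : α → ℚ) :
    supportCard (f + g) ≤ supportCard f + supportCard g := by
  have h := supportCard_sub_le f ((-1 : ℚ) • g)
  rw [supportCard_smul (by norm_num)] at h
  simpa using h

theorem one_le_supportCard {α : Type*} [Fintype α] {f : α → ℚ} (hf : f ≠ 0) :
    1 ≤ supportCard f := by
  obtain ⟨x, hx⟩ := Function.ne_iff.1 hf
  exact Finset.card_pos.2 ⟨x, by simpa using hx⟩

theorem supportCard_const {n q : ℕ} {v : ℚ} (hv : v ≠ 0) :
    supportCard (fun _ : Fin n → Fin q => v) = q ^ n := by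
  simp [supportCard, hv]

/-! ### Functions with restricted spectrum -/

/-- `InBand n i j f` says that `f` belongs to the sum of the eigenspaces of `H(n,q)` with
eigenvalues `n(q-1) - qt`, `i ≤ t ≤ j`. It is encoded by recursion on `n`: for every coordinate,
the sum of the slices lies in the same band and the differences of slices lie in the band lowered
by one. The bounds are integers so that the band may leave `[0, n]`. -/
def InBand {q : ℕ} : (n : ℕ) → ℤ → ℤ → ((Fin n → Fin q) → ℚ) → Prop
  | 0, i, j, f => f = 0 ∨ (i ≤ 0 ∧ 0 ≤ j)
  | n + 1, i, j, f => ∀ k : Fin (n + 1), InBand n i j (∑ a, hammingSlice k a f) ∧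
      ∀ a b, InBand n (i - 1) (j - 1) (hammingSlice k a f - hammingSlice k b f)

namespace InBand

variable {q n : ℕ} {i j : ℤ} {f g : (Fin n → Fin q) → ℚ}

theorem zero (n : ℕ) (i j : ℤ) : InBand n i j (0 : (Fin n → Fin q) → ℚ) := by
  induction n generalizing i j with
  | zero => exact Or.inl rfl
  | succ n ih =>
    intro k
    have h : ∀ a : Fin q, hammingSlice k a (0 : (Fin (n + 1) → Fin q) → ℚ) = 0 := fun _ => rfl
    simp only [h, Finset.sum_const_zero, sub_zero]
    exact ⟨ih i j, fun _ _ => ih _ _⟩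

theorem add (hf : InBand n i j f) (hg : InBand n i j g) : InBand n i j (f + g) := by
  induction n generalizing i j with
  | zero =>
    rcases hf with rfl | h
    · rcases hg with rfl | h
      · exact Or.inl (by simp)
      · exact Or.inr h
    · exact Or.inr h
  | succ n ih =>
    intro k
    have h : ∀ a : Fin q, hammingSlice k a (f + g) = hammingSlice k a f + hammingSlice k a g :=
      fun _ => rfl
    simp only [h, Finset.sum_add_distrib, add_sub_add_comm]
    exact ⟨ih (hf k).1 (hg k).1, fun a b => ih ((hf k).2 a b) ((hg k).2 a b)⟩

theorem smul (r : ℚ) (hf : InBand n i j f) : InBand n i j (r • f) := by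
  induction n generalizing i j with
  | zero =>
    rcases hf with rfl | h
    · exact Or.inl (by simp)
    · exact Or.inr h
  | succ n ih =>
    intro k
    have h : ∀ a : Fin q, hammingSlice k a (r • f) = r • hammingSlice k a f := fun _ => rfl
    simp only [h, ← Finset.smul_sum, ← smul_sub]
    exact ⟨ih (hf k).1, fun a b => ih ((hf k).2 a b)⟩

theorem sum {ι : Type*} (s : Finset ι) {F : ι → (Fin n → Fin q) → ℚ}
    (h : ∀ a ∈ s, InBand n i j (F a)) : InBand n i j (∑ a ∈ s, F a) := by
  classical
  induction s using Finset.induction_on with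
  | empty => exact zero n i j
  | insert a s ha ih =>
    rw [Finset.sum_insert ha]
    exact (h a (by simp)).add (ih fun b hb => h b (Finset.mem_insert_of_mem hb))

theorem mono {i' j' : ℤ} (hi : i' ≤ i) (hj : j ≤ j') (hf : InBand n i j f) :
    InBand n i' j' f := by
  induction n generalizing i j i' j' with
  | zero => exact hf.imp id fun h => ⟨hi.trans h.1, h.2.trans hj⟩
  | succ n ih =>
    exact fun k => ⟨ih hi hj (hf k).1, fun a b => ih (by omega) (by omega) ((hf k).2 a b)⟩

theorem inter {i' j' : ℤ} (hf : InBand n i j f) (hf' : InBand n i' j' f) :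
    InBand n (max i i') (min j j') f := by
  induction n generalizing i j i' j' with
  | zero =>
    rcases hf with h | h
    · exact Or.inl h
    · rcases hf' with h' | h'
      · exact Or.inl h'
      · exact Or.inr (by omega)
  | succ n ih =>
    intro k
    refine ⟨ih (hf k).1 (hf' k).1, fun a b => ?_⟩
    have h := ih ((hf k).2 a b) ((hf' k).2 a b)
    rwa [← max_sub_sub_right, ← min_sub_sub_right]

theorem univ (f : (Fin n → Fin q) → ℚ) : InBand n 0 n f := by
  induction n with
  | zero => exact Or.inr (by simp)
  | succ n ih =>
    exact fun k => ⟨(ih _).mono le_rfl (by simp), fun a b => (ih _).mono (by simp) (by simp)⟩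

/-- If all slices in one direction agree, each of them inherits the band. -/
theorem slice_of_eq {n : ℕ} {f : (Fin (n + 1) → Fin q) → ℚ} {g : (Fin n → Fin q) → ℚ}
    (hq : q ≠ 0) (hf : InBand (n + 1) i j f) (k : Fin (n + 1))
    (h : ∀ a, hammingSlice k a f = g) : InBand n i j g := by
  have h1 := (hf k).1
  simp only [h, Finset.sum_const, Finset.card_univ, Fintype.card_fin] at h1
  have h2 := h1.smul ((q : ℚ)⁻¹)
  rwa [← Nat.cast_smul_eq_nsmul ℚ, smul_smul, inv_mul_cancel₀ (by exact_mod_cast hq),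
    one_smul] at h2

/-- The eigenspaces are independent: an empty band contains only the zero function. -/
theorem eq_zero_of_lt (hq : q ≠ 0) (hij : j < i) (hf : InBand n i j f) : f = 0 := by
  induction n generalizing i j with
  | zero => exact hf.resolve_right (by omega)
  | succ n ih =>
    have hd : ∀ a b, hammingSlice 0 a f = hammingSlice 0 b f := fun a b =>
      sub_eq_zero.1 (ih (by omega) ((hf 0).2 a b))
    refine hammingSlice_ext 0 fun a => ?_
    exact ih hij (hf.slice_of_eq hq 0 fun b => hd b a)

theorem eq_zero_of_neg (hq : q ≠ 0) (hj : j < 0) (hf : InBand n i j f) : f = 0 :=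
  ((univ f).inter hf).eq_zero_of_lt hq (by omega)

theorem le (hq : q ≠ 0) (hf0 : f ≠ 0) (hf : InBand n i j f) : i ≤ j :=
  not_lt.1 fun h => hf0 (hf.eq_zero_of_lt hq h)

theorem nonneg (hq : q ≠ 0) (hf0 : f ≠ 0) (hf : InBand n i j f) : 0 ≤ j :=
  not_lt.1 fun h => hf0 (hf.eq_zero_of_neg hq h)

/-- A slice of `f` is recovered from the sum of the slices and their differences. -/
theorem slice {n : ℕ} {f : (Fin (n + 1) → Fin q) → ℚ}
    (hq : q ≠ 0) (hf : InBand (n + 1) i j f) (k : Fin (n + 1)) (a : Fin q) :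
    InBand n (i - 1) j (hammingSlice k a f) := by
  have h1 : InBand n (i - 1) j ((∑ b, hammingSlice k b f) +
      ∑ b, (hammingSlice k a f - hammingSlice k b f)) :=
    ((hf k).1.mono (by omega) le_rfl).add
      (sum _ fun b _ => ((hf k).2 a b).mono le_rfl (by omega))
  have h2 := h1.smul ((q : ℚ)⁻¹)
  rwa [← Finset.sum_add_distrib, Finset.sum_congr rfl fun b _ => add_sub_cancel _ _,
    Finset.sum_const, Finset.card_univ, Fintype.card_fin, ← Nat.cast_smul_eq_nsmul ℚ, smul_smul,
    inv_mul_cancel₀ (by exact_mod_cast hq), one_smul] at h2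

/-- A nonzero constant has a component in the eigenspace of index `0`. -/
theorem nonpos_of_const (hq : q ≠ 0) {v : ℚ} (hv : v ≠ 0)
    (hf : InBand n i j (fun _ : Fin n → Fin q => v)) : i ≤ 0 := by
  induction n with
  | zero =>
    rcases hf with h | h
    · exact absurd (congrFun h Fin.elim0) hv
    · exact h.1
  | succ n ih => exact ih (hf.slice_of_eq hq 0 fun _ => rfl)

end InBand

/-! ### Eigenfunctions -/

/-- The adjacency operator of `H(n,q)` plus `n` times the identity: the sum of `f` over all lines
through a point. -/
def lineSum {n q : ℕ} (f : (Fin n → Fin q) → ℚ) : (Fin n → Fin q) → ℚ :=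
  fun x => ∑ k, ∑ a, f (Function.update x k a)

theorem hammingSlice_lineSum {n q : ℕ} (f : (Fin (n + 1) → Fin q) → ℚ) (k : Fin (n + 1))
    (a : Fin q) :
    hammingSlice k a (lineSum f) =
      (∑ b, hammingSlice k b f) + lineSum (hammingSlice k a f) := by
  funext y
  simp only [hammingSlice, lineSum, Fin.sum_univ_succAbove _ k, Fin.update_insertNth,
    Fin.insertNth_update, Pi.add_apply, Finset.sum_apply]

theorem lineSum_sub {n q : ℕ} (f g : (Fin n → Fin q) → ℚ) :
    lineSum (f - g) = lineSum f - lineSum g := by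
  funext x
  simp [lineSum, Finset.sum_sub_distrib]

theorem lineSum_sum {n q : ℕ} {ι : Type*} (s : Finset ι) (F : ι → (Fin n → Fin q) → ℚ) :
    lineSum (∑ a ∈ s, F a) = ∑ a ∈ s, lineSum (F a) := by
  funext x
  simp only [lineSum, Finset.sum_apply]
  exact (Finset.sum_congr rfl fun k _ => Finset.sum_comm).trans Finset.sum_comm

section
variable {n q : ℕ} {μ : ℚ} {f : (Fin (n + 1) → Fin q) → ℚ}

theorem lineSum_slice_sub (hf : lineSum f = μ • f) (k : Fin (n + 1)) (a b : Fin q) :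
    lineSum (hammingSlice k a f - hammingSlice k b f) =
      μ • (hammingSlice k a f - hammingSlice k b f) := by
  have h : ∀ a, hammingSlice k a (lineSum f) = μ • hammingSlice k a f := fun a => by
    rw [hf]; rfl
  have ha := (hammingSlice_lineSum f k a).symm.trans (h a)
  have hb := (hammingSlice_lineSum f k b).symm.trans (h b)
  rw [lineSum_sub, smul_sub, ← ha, ← hb, add_sub_add_left_eq_sub]

theorem lineSum_slice_sum (hf : lineSum f = μ • f) (k : Fin (n + 1)) :
    lineSum (∑ a, hammingSlice k a f) = (μ - q) • ∑ a, hammingSlice k a f := by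
  have h : ∀ a, lineSum (hammingSlice k a f) =
      μ • hammingSlice k a f - ∑ b, hammingSlice k b f := fun a => by
    rw [eq_sub_iff_add_eq', ← hammingSlice_lineSum, hf]; rfl
  rw [lineSum_sum, Finset.sum_congr rfl fun a _ => h a, Finset.sum_sub_distrib,
    ← Finset.smul_sum, Finset.sum_const, Finset.card_univ, Fintype.card_fin, sub_smul,
    Nat.cast_smul_eq_nsmul]

end

/-- Eigenfunctions of index `i` lie in the band `[i, i]`: passing to sums and differences of slices
shifts the eigenvalue of `lineSum` by `q` and `0`. -/
theorem InBand.of_lineSum_eq {n q : ℕ} (hq : q ≠ 0) {f : (Fin n → Fin q) → ℚ} {i : ℤ}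
    (hf : lineSum f = ((q : ℚ) * (n - i)) • f) : InBand n i i f := by
  induction n generalizing i with
  | zero =>
    rcases eq_or_ne f 0 with h | h
    · exact Or.inl h
    · have h1 : ((q : ℚ) * ((0 : ℕ) - i)) • f = 0 := by
        rw [← hf]; funext x; simp [lineSum]
      have h2 : (i : ℚ) = 0 := by
        rcases smul_eq_zero.1 h1 with h1 | h1
        · have hq' : (q : ℚ) ≠ 0 := by exact_mod_cast hq
          have := (mul_eq_zero.1 h1).resolve_left hq'
          push_cast at this; linarith
        · exact absurd h1 h
      have h3 : i = 0 := by exact_mod_cast h2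
      exact Or.inr (by omega)
  | succ n ih =>
    intro k
    refine ⟨ih ?_, fun a b => ih ?_⟩
    · rw [lineSum_slice_sum hf]; congr 1; push_cast; ring
    · rw [lineSum_slice_sub hf]; congr 1; push_cast; ring

/-- The eigenvalues of `lineSum` on `H(n,q)` are the numbers `q(n-i)` with `0 ≤ i ≤ n`. -/
theorem exists_eq_of_lineSum_eq {n q : ℕ} {f : (Fin n → Fin q) → ℚ} (hf0 : f ≠ 0) {μ : ℚ}
    (hf : lineSum f = μ • f) : ∃ t : ℕ, t ≤ n ∧ μ = q * t := by
  induction n generalizing μ with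
  | zero =>
    have h1 : μ • f = 0 := by
      rw [← hf]; funext x; simp [lineSum]
    exact ⟨0, le_rfl, by simpa using (smul_eq_zero.1 h1).resolve_right hf0⟩
  | succ n ih =>
    by_cases hs : ∑ a, hammingSlice 0 a f = 0
    · by_cases hd : ∃ a b, hammingSlice 0 a f - hammingSlice 0 b f ≠ 0
      · obtain ⟨a, b, hab⟩ := hd
        obtain ⟨t, ht, h⟩ := ih hab (lineSum_slice_sub hf 0 a b)
        exact ⟨t, by omega, h⟩
      · push Not at hd
        refine absurd (hammingSlice_ext 0 fun a => ?_) hf0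
        have h : ∀ b, hammingSlice 0 b f = hammingSlice 0 a f := fun b => sub_eq_zero.1 (hd b a)
        simp only [h, Finset.sum_const, Finset.card_univ, Fintype.card_fin] at hs
        have hq : q ≠ 0 := fun h => by subst h; exact a.elim0
        exact (smul_eq_zero.1 hs).resolve_left hq
    · obtain ⟨t, ht, h⟩ := ih hs (lineSum_slice_sum hf 0)
      exact ⟨t + 1, by omega, by push_cast; linarith⟩

/-! ### Families of slices in one direction -/

/-- A family indexed by at least four letters either contains two disjoint pairs of unequal members
or has all members but one equal. -/
theorem two_unequal_pairs_or_near_const {X : Type*} {q : ℕ} (hq : 4 ≤ q) (F : Fin q → X) :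
    (∃ a b c d, F a ≠ F b ∧ F c ≠ F d ∧ [a, b, c, d].Nodup) ∨
      ∃ c, ∀ a b, a ≠ c → b ≠ c → F a = F b := by
  classical
  by_cases h : ∃ a b c d, F a ≠ F b ∧ F c ≠ F d ∧ [a, b, c, d].Nodup
  · exact Or.inl h
  right
  by_cases h' : ∃ a b, F a ≠ F b
  · obtain ⟨a, b, hab⟩ := h'
    have hne : a ≠ b := fun h => hab (by rw [h])
    have hcd : ∀ c d, c ≠ a → c ≠ b → d ≠ a → d ≠ b → F c = F d := by
      intro c d hca hcb hda hdb
      by_contra hcd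
      have hne' : c ≠ d := fun h => hcd (by rw [h])
      exact h ⟨a, b, c, d, hab, hcd, by simp; tauto⟩
    have hcard : 1 < (({a, b} : Finset (Fin q))ᶜ).card := by
      rw [Finset.card_compl, Finset.card_pair hne, Fintype.card_fin]; omega
    obtain ⟨c, hc, d, hd, hne'⟩ := Finset.one_lt_card.1 hcard
    simp only [Finset.mem_compl, Finset.mem_insert, Finset.mem_singleton, not_or] at hc hd
    have hv := hcd c d hc.1 hc.2 hd.1 hd.2
    -- otherwise the common value differs from `F a` and `F b`, and `{a, c}`, `{b, d}` are unequal
    have hor : F c = F a ∨ F c = F b := by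
      by_contra hn
      push Not at hn
      refine h ⟨a, c, b, d, hn.1.symm, hv ▸ hn.2.symm, ?_⟩
      simp; tauto
    rcases hor with hca | hcb
    · refine ⟨b, ?_⟩
      have : ∀ x, x ≠ b → F x = F a := fun x hx => by
        by_cases hxa : x = a
        · rw [hxa]
        · rw [← hca]; exact hcd x c hxa hx hc.1 hc.2
      exact fun x y hx hy => (this x hx).trans (this y hy).symm
    · refine ⟨a, ?_⟩
      have : ∀ x, x ≠ a → F x = F b := fun x hx => by
        by_cases hxb : x = b
        · rw [hxb]
        · rw [← hcb]; exact hcd x c hx hxb hc.1 hc.2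
      exact fun x y hx hy => (this x hx).trans (this y hy).symm
  · push Not at h'
    exact ⟨⟨0, by omega⟩, fun a b _ _ => h' a b⟩

theorem injective_or_near_const_of_three {X : Type*} (F : Fin 3 → X) :
    (F 0 ≠ F 1 ∧ F 0 ≠ F 2 ∧ F 1 ≠ F 2) ∨ ∃ c, ∀ a b, a ≠ c → b ≠ c → F a = F b := by
  by_cases h01 : F 0 = F 1
  · exact Or.inr ⟨2, by simp [Fin.forall_fin_succ, h01]⟩
  by_cases h02 : F 0 = F 2
  · exact Or.inr ⟨1, by simp [Fin.forall_fin_succ, h02]⟩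
  by_cases h12 : F 1 = F 2
  · exact Or.inr ⟨0, by simp [Fin.forall_fin_succ, h12]⟩
  exact Or.inl ⟨h01, h02, h12⟩

section
variable {n q : ℕ} {f : (Fin (n + 1) → Fin q) → ℚ} {k : Fin (n + 1)}

theorem supportCard_slice_sub_le {a b : Fin q} (hab : a ≠ b) :
    supportCard (hammingSlice k a f - hammingSlice k b f) ≤ supportCard f := by
  classical
  rw [supportCard_eq_sum_hammingSlice k f]
  refine (supportCard_sub_le _ _).trans ?_
  rw [← Finset.sum_pair hab (f := fun a => supportCard (hammingSlice k a f))]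
  exact Finset.sum_le_sum_of_subset (Finset.subset_univ _)

theorem supportCard_two_pairs_le {a b c d : Fin q} (h : [a, b, c, d].Nodup) :
    supportCard (hammingSlice k a f - hammingSlice k b f) +
      supportCard (hammingSlice k c f - hammingSlice k d f) ≤ supportCard f := by
  classical
  rw [supportCard_eq_sum_hammingSlice k f]
  refine (add_le_add (supportCard_sub_le _ _) (supportCard_sub_le _ _)).trans ?_
  simp only [List.nodup_cons, List.mem_cons, List.not_mem_nil, or_false, not_or] at h
  rw [← Finset.sum_pair h.1.1 (f := fun a => supportCard (hammingSlice k a f)),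
    ← Finset.sum_pair h.2.2.1 (f := fun a => supportCard (hammingSlice k a f)),
    ← Finset.sum_union]
  · exact Finset.sum_le_sum_of_subset (Finset.subset_univ _)
  · rw [Finset.disjoint_left]
    intro x
    simp only [Finset.mem_insert, Finset.mem_singleton]
    rintro (rfl | rfl) <;> tauto

theorem sum_eq_of_near_const {M : Type*} [AddCommMonoid M] {p : ℕ} {F : Fin (p + 1) → M}
    {c : Fin (p + 1)} {g : M} (h : ∀ a, a ≠ c → F a = g) : ∑ a, F a = p • g + F c := by
  classical
  rw [← Finset.sum_erase_add _ _ (Finset.mem_univ c),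
    Finset.sum_congr rfl fun a ha => h a (Finset.ne_of_mem_erase ha), Finset.sum_const,
    Finset.card_erase_of_mem (Finset.mem_univ _), Finset.card_univ, Fintype.card_fin,
    Nat.add_sub_cancel]

end

/-- The data of a direction in which all slices but one agree: `g` is the common slice, `h` the
exceptional one. The support is counted with multiplicities, and the band conditions on the slices
become conditions on `g` and `h`. -/
theorem exists_near_const_data {p n : ℕ} (hp : 1 ≤ p) {i j : ℤ}
    {f : (Fin (n + 1) → Fin (p + 1)) → ℚ} (hf : InBand (n + 1) i j f) {k : Fin (n + 1)}
    {c : Fin (p + 1)}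
    (hc : ∀ a b, a ≠ c → b ≠ c → hammingSlice k a f = hammingSlice k b f) :
    ∃ a, a ≠ c ∧ ∃ g h, hammingSlice k a f = g ∧ hammingSlice k c f = h ∧
      (∀ b, b ≠ c → hammingSlice k b f = g) ∧
      supportCard f = p * supportCard g + supportCard h ∧
      InBand n (i - 1) j g ∧ InBand n (i - 1) j h ∧ InBand n (i - 1) (j - 1) (g - h) ∧
      InBand n i j ((p : ℚ) • g + h) := by
  obtain ⟨a, ha⟩ : ∃ a : Fin (p + 1), a ≠ c := by
    have : Nontrivial (Fin (p + 1)) := Fin.nontrivial_iff_two_le.2 (by omega)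
    exact exists_ne c
  have hg : ∀ b, b ≠ c → hammingSlice k b f = hammingSlice k a f := fun b hb => hc b a hb ha
  refine ⟨a, ha, _, _, rfl, rfl, hg, ?_, hf.slice (by omega) k a, hf.slice (by omega) k c,
    (hf k).2 a c, ?_⟩
  · rw [supportCard_eq_sum_hammingSlice k f,
      sum_eq_of_near_const (c := c) fun b hb => congrArg supportCard (hg b hb), smul_eq_mul]
  · have h := (hf k).1
    rwa [sum_eq_of_near_const (c := c) hg, ← Nat.cast_smul_eq_nsmul ℚ] at h

namespace InBand

variable {p n : ℕ} {i j : ℤ} {g h : (Fin n → Fin (p + 1)) → ℚ}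

theorem right_of_left_eq_zero (hg : g = 0) (hd : InBand n (i - 1) (j - 1) (g - h))
    (hs : InBand n i j ((p : ℚ) • g + h)) : InBand n i (j - 1) h := by
  subst hg
  have h1 := hd.smul (-1)
  simp only [zero_sub, neg_smul, one_smul, neg_neg, smul_zero, zero_add] at h1 hs
  exact (hs.inter h1).mono (by omega) (by omega)

theorem left_of_right_eq_zero (hp : 1 ≤ p) (hh : h = 0) (hd : InBand n (i - 1) (j - 1) (g - h))
    (hs : InBand n i j ((p : ℚ) • g + h)) : InBand n i (j - 1) g := by
  subst hh
  rw [sub_zero] at hd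
  have h1 := hs.smul ((p : ℚ)⁻¹)
  rw [add_zero, smul_smul, inv_mul_cancel₀ (by positivity), one_smul] at h1
  exact (h1.inter hd).mono (by omega) (by omega)

end InBand

/-! ### Lower bounds for bands below the middle -/

theorem const_of_slices_eq {n q : ℕ} {f : (Fin (n + 1) → Fin q) → ℚ}
    (h : ∀ k a b, hammingSlice k a f = hammingSlice k b f) : ∃ v, f = fun _ => v := by
  classical
  rcases isEmpty_or_nonempty (Fin (n + 1) → Fin q) with he | ⟨⟨y⟩⟩
  · exact ⟨0, funext fun x => he.elim x⟩
  refine ⟨f y, funext fun x => ?_⟩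
  have hu : ∀ (z : Fin (n + 1) → Fin q) k a, f (Function.update z k a) = f z := by
    intro z k a
    have h1 := congrFun (h k a (z k)) (k.removeNth z)
    simpa [hammingSlice] using h1
  have hs : ∀ s : Finset (Fin (n + 1)), f (s.piecewise x y) = f y := by
    intro s
    induction s using Finset.induction_on with
    | empty => simp
    | insert k s _ ih => rw [Finset.piecewise_insert, hu, ih]
  simpa using hs Finset.univ

/-- The bound for bands whose lower end `i` and upper end `j` satisfy `i + j ≤ n`. -/
theorem supportCard_ge_of_add_le {p : ℕ} (hp : 2 ≤ p) (n : ℕ) : ∀ i j r : ℕ, n = i + j + r →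
    ∀ f : (Fin n → Fin (p + 1)) → ℚ, f ≠ 0 → InBand n i j f →
      (2 * p) ^ i * (p + 1) ^ r ≤ supportCard f := by
  induction n with
  | zero =>
    intro i j r hn f hf0 _
    obtain rfl : i = 0 := by omega
    obtain rfl : r = 0 := by omega
    simpa using one_le_supportCard hf0
  | succ n ih =>
    intro i j r hn f hf0 hf
    -- constants are set aside because a direction with equal slices need not keep `i + j ≤ n`
    by_cases hconst : ∀ k a b, hammingSlice k a f = hammingSlice k b f
    · obtain ⟨v, rfl⟩ := const_of_slices_eq hconst
      have hv : v ≠ 0 := by rintro rfl; exact hf0 rfl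
      obtain rfl : i = 0 := by have := hf.nonpos_of_const (by omega) hv; omega
      rw [supportCard_const hv, pow_zero, one_mul]
      exact Nat.pow_le_pow_right (by omega) (by omega)
    push Not at hconst
    obtain ⟨k, a₀, b₀, hab₀⟩ := hconst
    have hab₀' := sub_ne_zero.2 hab₀
    have hj : 1 ≤ j := by
      have := ((hf k).2 a₀ b₀).nonneg (by omega) hab₀'; omega
    obtain ⟨j, rfl⟩ := Nat.exists_eq_add_of_le' hj
    simp only [Nat.cast_add, Nat.cast_one] at hf
    rcases Nat.eq_zero_or_pos i with rfl | hi
    -- for `i = 0` lowering the band leaves the lower end at `0`, so one unequal pair suffices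
    · have h1 : InBand n (0 : ℕ) j (hammingSlice k a₀ f - hammingSlice k b₀ f) := by
        have := ((InBand.univ _).inter ((hf k).2 a₀ b₀))
        exact this.mono (by simp) (by simp)
      exact (ih 0 j r (by omega) _ hab₀' h1).trans
        (supportCard_slice_sub_le fun h => hab₀ (by rw [h]))
    obtain ⟨i, rfl⟩ := Nat.exists_eq_add_of_le' hi
    have hsub : ∀ a b, hammingSlice k a f ≠ hammingSlice k b f →
        (2 * p) ^ i * (p + 1) ^ (r + 1) ≤
          supportCard (hammingSlice k a f - hammingSlice k b f) := fun a b hab =>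
      ih i j (r + 1) (by omega) _ (sub_ne_zero.2 hab)
        (((hf k).2 a b).mono (by push_cast; omega) (by omega))
    set X := (2 * p) ^ i * (p + 1) ^ r with hX
    have e1 : (2 * p) ^ i * (p + 1) ^ (r + 1) = X * (p + 1) := by rw [hX]; ring
    have e2 : (2 * p) ^ (i + 1) * (p + 1) ^ r = X * (2 * p) := by rw [hX]; ring
    rw [e2]
    simp only [e1] at hsub
    have hnear : (∃ c, ∀ a b, a ≠ c → b ≠ c → hammingSlice k a f = hammingSlice k b f) →
        X * (2 * p) ≤ supportCard f := by
      rintro ⟨c, hc⟩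
      obtain ⟨a, ha, g, h, hga, hhc, hg, hcard, bg, bh, bd, bs⟩ :=
        exists_near_const_data (by omega) hf hc
      have hgh : g ≠ h := by
        rintro rfl
        refine hab₀ ?_
        have : ∀ b, hammingSlice k b f = g := fun b => by
          by_cases hb : b = c
          · rw [hb, hhc]
          · exact hg b hb
        rw [this, this]
      rw [hcard]
      have hs := hsub a c (by rw [hga, hhc]; exact hgh)
      rw [hga, hhc] at hs
      by_cases hg0 : g = 0
      · have bh' := InBand.right_of_left_eq_zero hg0 bd bs
        have hh0 : h ≠ 0 := fun h0 => hgh (hg0.trans h0.symm)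
        have := ih (i + 1) j r (by omega) h hh0 (bh'.mono (by push_cast; omega) (by omega))
        rw [e2] at this
        omega
      -- `p |g| + |h| ≥ (p - 1) |g| + |g - h|`
      · have h1 := ih i (j + 1) r (by omega) g hg0
          (bg.mono (by push_cast; omega) (by push_cast; omega))
        have h2 := hs.trans (supportCard_sub_le g h)
        obtain ⟨p, rfl⟩ := Nat.exists_eq_add_of_le' hp
        nlinarith
    rcases hp.eq_or_lt with rfl | hp3
    -- three distinct slices: each slice occurs in two of the three differences
    · rcases injective_or_near_const_of_three (fun a => hammingSlice k a f) with h3 | h3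
      · have h01 := (hsub 0 1 h3.1).trans (supportCard_sub_le _ _)
        have h02 := (hsub 0 2 h3.2.1).trans (supportCard_sub_le _ _)
        have h12 := (hsub 1 2 h3.2.2).trans (supportCard_sub_le _ _)
        rw [supportCard_eq_sum_hammingSlice k f, Fin.sum_univ_three]
        omega
      · exact hnear h3
    · rcases two_unequal_pairs_or_near_const (by omega) (fun a => hammingSlice k a f) with h4 | h4
      · obtain ⟨a, b, c, d, hab, hcd, hnd⟩ := h4
        have h1 := supportCard_two_pairs_le (f := f) (k := k) hnd
        have h2 := hsub a b hab
        have h3 := hsub c d hcd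
        nlinarith
      · exact hnear h4

/-! ### Functions near constant in every direction -/

/-- `f` depends, in every coordinate `k`, only on whether the letter is `c k`. -/
def IsNearConst {n q : ℕ} (c : Fin n → Fin q) (f : (Fin n → Fin q) → ℚ) : Prop :=
  ∀ k x a b, a ≠ c k → b ≠ c k → f (Function.update x k a) = f (Function.update x k b)

namespace IsNearConst

theorem slice_eq {n q : ℕ} {c : Fin (n + 1) → Fin q} {f : (Fin (n + 1) → Fin q) → ℚ}
    (hf : IsNearConst c f) (k : Fin (n + 1)) {a b : Fin q} (ha : a ≠ c k) (hb : b ≠ c k) :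
    hammingSlice k a f = hammingSlice k b f := by
  funext y
  have h := hf k (k.insertNth a y) a b ha hb
  simpa only [Fin.update_insertNth, hammingSlice] using h

theorem of_slices {n q : ℕ} {c : Fin (n + 1) → Fin q} {f : (Fin (n + 1) → Fin q) → ℚ}
    (h : ∀ k a b, a ≠ c k → b ≠ c k → hammingSlice k a f = hammingSlice k b f) :
    IsNearConst c f := by
  intro k x a b ha hb
  have h1 := congrFun (h k a b ha hb) (k.removeNth x)
  simpa [hammingSlice] using h1

theorem slice {n q : ℕ} {c : Fin (n + 1) → Fin q} {f : (Fin (n + 1) → Fin q) → ℚ}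
    (hf : IsNearConst c f) (k : Fin (n + 1)) (a : Fin q) :
    IsNearConst (fun l => c (k.succAbove l)) (hammingSlice k a f) := by
  intro l x b d hb hd
  simp only [hammingSlice, Fin.insertNth_update]
  exact hf _ _ _ _ hb hd

variable {n q : ℕ} {c : Fin n → Fin q} {f g : (Fin n → Fin q) → ℚ}

theorem add (hf : IsNearConst c f) (hg : IsNearConst c g) : IsNearConst c (f + g) := by
  intro k x a b ha hb
  simp only [Pi.add_apply, hf k x a b ha hb, hg k x a b ha hb]

theorem smul (r : ℚ) (hf : IsNearConst c f) : IsNearConst c (r • f) := by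
  intro k x a b ha hb
  simp only [Pi.smul_apply, hf k x a b ha hb]

end IsNearConst

/-- The bound for functions that are near constant in every direction; it improves on the general
one when the band lies above the middle. -/
theorem IsNearConst.supportCard_ge {p : ℕ} (hp : 2 ≤ p) (n : ℕ) : ∀ i j d e : ℕ,
    n = j + d → i = d + e → ∀ (c : Fin n → Fin (p + 1)) (f : (Fin n → Fin (p + 1)) → ℚ), f ≠ 0 →
      IsNearConst c f → InBand n i j f → (2 * p) ^ d * (p + 1) ^ e ≤ supportCard f := by
  induction n with
  | zero =>
    intro i j d e hn hi c f hf0 _ hf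
    have := hf.le (by omega) hf0
    obtain rfl : e = 0 := by omega
    obtain rfl : d = 0 := by omega
    simpa using one_le_supportCard hf0
  | succ n ih =>
    intro i j d e hn hi c f hf0 hc hf
    rcases Nat.eq_zero_or_pos e with rfl | he
    · exact supportCard_ge_of_add_le hp _ i j 0 (by omega) f hf0 hf |>.trans' (by rw [hi]; simp)
    obtain ⟨e, rfl⟩ := Nat.exists_eq_add_of_le' he
    have hij := hf.le (by omega) hf0
    obtain ⟨j, rfl⟩ : ∃ j', j = j' + 1 := ⟨j - 1, by omega⟩
    obtain ⟨a, ha, g, h, hga, hhc, hg, hcard, bg, bh, bd, bs⟩ :=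
        exists_near_const_data (by omega) hf (k := 0) (c := c 0) fun a b => hc.slice_eq 0
    have cg : IsNearConst (fun l => c (Fin.succAbove 0 l)) g := hga ▸ hc.slice 0 a
    have ch : IsNearConst (fun l => c (Fin.succAbove 0 l)) h := hhc ▸ hc.slice 0 (c 0)
    have hgh0 : ¬ (g = 0 ∧ h = 0) := by
      rintro ⟨g0, h0⟩
      refine hf0 (hammingSlice_ext 0 fun b => ?_)
      by_cases hb : b = c 0
      · rw [hb, hhc, h0]; rfl
      · rw [hg b hb, g0]; rfl
    rw [hcard]
    by_cases hg0 : g = 0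
    · have bh' := InBand.right_of_left_eq_zero hg0 bd bs
      have := ih i j d (e + 1) (by omega) hi _ h (fun h0 => hgh0 ⟨hg0, h0⟩) ch
        (bh'.mono le_rfl (by push_cast; omega))
      exact this.trans (Nat.le_add_left _ _)
    rcases Nat.eq_zero_or_pos d with rfl | hd
    · -- `j + 1 = n + 1`: no upper condition is left
      by_cases hh0 : h = 0
      · have bg' := InBand.left_of_right_eq_zero (by omega) hh0 bd bs
        have := ih i j 0 (e + 1) (by omega) hi _ g hg0 cg (bg'.mono le_rfl (by push_cast; omega))
        nlinarith
      · have top : ∀ u : (Fin n → Fin (p + 1)) → ℚ, u ≠ 0 →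
            IsNearConst (fun l => c (Fin.succAbove 0 l)) u →
            InBand n (i - 1) (j + 1 : ℕ) u → (2 * p) ^ 0 * (p + 1) ^ e ≤ supportCard u :=
          fun u hu cu bu => ih e j 0 e (by omega) (by omega) _ u hu cu
            ((bu.inter (InBand.univ u)).mono (by omega) (by omega))
        have h1 := top g hg0 cg bg
        have h2 := top h hh0 ch bh
        rw [pow_succ]
        nlinarith
    · obtain ⟨d, rfl⟩ := Nat.exists_eq_add_of_le' hd
      -- if `p g + h = 0`, then `g` is a multiple of `g - h` and lies in the lower band
      by_cases hs0 : (p : ℚ) • g + h = 0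
      · have hh : h = -((p : ℚ) • g) := eq_neg_of_add_eq_zero_right hs0
        have hp0 : (p : ℚ) ≠ 0 := by positivity
        have hcardh : supportCard h = supportCard g := by
          rw [hh, ← neg_smul, supportCard_smul (neg_ne_zero.2 hp0)]
        have bg' : InBand n (i - 1 : ℤ) ((j + 1 : ℕ) - 1 : ℤ) g := by
          have h1 := bd.smul (((p : ℚ) + 1)⁻¹)
          have h2 : g - h = ((p : ℚ) + 1) • g := by rw [hh, add_smul, one_smul]; abel
          rwa [h2, smul_smul, inv_mul_cancel₀ (by positivity), one_smul] at h1
        have := ih (d + 1 + e) j (d + 1) e (by omega) rfl _ g hg0 cg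
          (bg'.mono (by omega) (by push_cast; omega))
        rw [hcardh, pow_succ (p + 1)]
        nlinarith
      -- `p |g| + |h| ≥ (p - 1) |g| + |p g + h|`
      · have h1 := ih i (j + 1) d (e + 2) (by omega) (by omega) _ _ hs0 ((cg.smul _).add ch) bs
        have h2 := ih (d + (e + 1)) (j + 1) d (e + 1) (by omega) rfl _ g hg0 cg
          (bg.mono (by omega) le_rfl)
        have h3 := h1.trans (supportCard_add_le _ _)
        rw [supportCard_smul (by positivity)] at h3
        set X := (2 * p) ^ d * (p + 1) ^ (e + 1) with hX
        have e1 : (2 * p) ^ d * (p + 1) ^ (e + 2) = X * (p + 1) := by rw [hX]; ring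
        have e2 : (2 * p) ^ (d + 1) * (p + 1) ^ (e + 1) = X * (2 * p) := by rw [hX]; ring
        rw [e1] at h3
        rw [e2]
        obtain ⟨p, rfl⟩ := Nat.exists_eq_add_of_le' hp
        nlinarith

/-! ### Lower bounds for bands above the middle -/

/-- The bound for bands above the middle over an alphabet of at least four letters. -/
theorem supportCard_ge_of_le_add {p : ℕ} (hp : 3 ≤ p) (n : ℕ) : ∀ i j d e : ℕ,
    n = j + d → i = d + e → ∀ f : (Fin n → Fin (p + 1)) → ℚ, f ≠ 0 → InBand n i j f →
      2 ^ (d + e) * p ^ d ≤ supportCard f := by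
  induction n with
  | zero =>
    intro i j d e hn hi f hf0 hf
    have := hf.le (by omega) hf0
    obtain rfl : e = 0 := by omega
    obtain rfl : d = 0 := by omega
    simpa using one_le_supportCard hf0
  | succ n ih =>
    intro i j d e hn hi f hf0 hf
    rcases Nat.eq_zero_or_pos e with rfl | he
    · refine (supportCard_ge_of_add_le (by omega) _ i j 0 (by omega) f hf0 hf).trans' ?_
      rw [hi, add_zero, pow_zero, mul_one, mul_pow]
    by_cases hc : ∀ k, ∃ c, ∀ a b, a ≠ c → b ≠ c → hammingSlice k a f = hammingSlice k b f
    · choose c hc using hc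
      refine (IsNearConst.supportCard_ge (by omega) _ i j d e hn hi c f hf0
        (IsNearConst.of_slices hc) hf).trans' ?_
      rw [mul_pow, pow_add, mul_right_comm]
      exact Nat.mul_le_mul_left _ (Nat.pow_le_pow_left (by omega) e)
    push Not at hc
    obtain ⟨k, hk⟩ := hc
    obtain ⟨a, b, c, d', hab, hcd, hnd⟩ :=
      (two_unequal_pairs_or_near_const (by omega) (fun a => hammingSlice k a f)).resolve_right
        (by push Not; exact hk)
    obtain ⟨e, rfl⟩ := Nat.exists_eq_add_of_le' he
    have hij := hf.le (by omega) hf0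
    have hsub : ∀ a b, hammingSlice k a f ≠ hammingSlice k b f → 2 ^ (d + e) * p ^ d ≤
          supportCard (hammingSlice k a f - hammingSlice k b f) := fun a b hab =>
      ih (d + e) (j - 1) d e (by omega) rfl _ (sub_ne_zero.2 hab)
        (((hf k).2 a b).mono (by omega) (by omega))
    have h1 := supportCard_two_pairs_le (f := f) (k := k) hnd
    have h2 := hsub a b hab
    have h3 := hsub c d' hcd
    have e1 : 2 ^ (d + (e + 1)) * p ^ d = 2 * (2 ^ (d + e) * p ^ d) := by ring
    linarith

/-- The bound for bands above the middle over a three-letter alphabet. -/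
theorem supportCard_ge_of_le_add_three (n : ℕ) : ∀ i j d e : ℕ,
    n = j + d → i = d + e → ∀ f : (Fin n → Fin 3) → ℚ, f ≠ 0 → InBand n i j f →
      3 ^ d * 2 ^ e ≤ supportCard f := by
  induction n with
  | zero =>
    intro i j d e hn hi f hf0 hf
    have := hf.le (by omega) hf0
    obtain rfl : e = 0 := by omega
    obtain rfl : d = 0 := by omega
    simpa using one_le_supportCard hf0
  | succ n ih =>
    intro i j d e hn hi f hf0 hf
    rcases Nat.eq_zero_or_pos e with rfl | he
    · refine (supportCard_ge_of_add_le (p := 2) le_rfl _ i j 0 (by omega) f hf0 hf).trans' ?_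
      rw [hi, add_zero]
      exact Nat.mul_le_mul (Nat.pow_le_pow_left (by omega) d) le_rfl
    by_cases hc : ∀ k, ∃ c, ∀ a b, a ≠ c → b ≠ c → hammingSlice k a f = hammingSlice k b f
    · choose c hc using hc
      refine (IsNearConst.supportCard_ge (p := 2) le_rfl _ i j d e hn hi c f hf0
        (IsNearConst.of_slices hc) hf).trans' ?_
      exact Nat.mul_le_mul (Nat.pow_le_pow_left (by omega) d) (Nat.pow_le_pow_left (by omega) e)
    push Not at hc
    obtain ⟨k, hk⟩ := hc
    obtain ⟨h01, h02, h12⟩ :=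
      (injective_or_near_const_of_three (fun a => hammingSlice k a f)).resolve_right
        (by push Not; exact hk)
    obtain ⟨e, rfl⟩ := Nat.exists_eq_add_of_le' he
    have hij := hf.le (by omega) hf0
    have hsub : ∀ a b, hammingSlice k a f ≠ hammingSlice k b f → 3 ^ d * 2 ^ e ≤
          supportCard (hammingSlice k a f - hammingSlice k b f) := fun a b hab =>
      ih (d + e) (j - 1) d e (by omega) rfl _ (sub_ne_zero.2 hab)
        (((hf k).2 a b).mono (by omega) (by omega))
    have e1 : 3 ^ d * 2 ^ (e + 1) = 2 * (3 ^ d * 2 ^ e) := by ring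
    -- a vanishing slice forces the other two into the smaller band of the differences
    have hzero : ∀ a b, hammingSlice k a f = 0 → hammingSlice k b f ≠ hammingSlice k a f →
        3 ^ d * 2 ^ e ≤ supportCard (hammingSlice k b f) := fun a b ha hb => by
      have := hsub b a hb
      rwa [ha, sub_zero] at this
    rw [supportCard_eq_sum_hammingSlice k f, Fin.sum_univ_three, e1]
    by_cases h0 : hammingSlice k 0 f = 0
    · have := hzero 0 1 h0 h01.symm
      have := hzero 0 2 h0 h02.symm
      omega
    by_cases h1 : hammingSlice k 1 f = 0
    · have := hzero 1 0 h1 h01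
      have := hzero 1 2 h1 h12.symm
      omega
    by_cases h2 : hammingSlice k 2 f = 0
    · have := hzero 2 0 h2 h02
      have := hzero 2 1 h2 h12
      omega
    rcases Nat.eq_zero_or_pos d with rfl | hd
    · have top : ∀ a, hammingSlice k a f ≠ 0 → 3 ^ 0 * 2 ^ e ≤
          supportCard (hammingSlice k a f) := fun a ha =>
        ih e n 0 e (by omega) (by omega) _ ha
          (((hf.slice (by omega) k a).inter (InBand.univ _)).mono (by omega) (by omega))
      have := top 0 h0
      have := top 1 h1
      have := top 2 h2
      omega
    · obtain ⟨d, rfl⟩ := Nat.exists_eq_add_of_le' hd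
      have hall : ∀ a, hammingSlice k a f ≠ 0 → 3 ^ d * 2 ^ (e + 1) ≤
          supportCard (hammingSlice k a f) := fun a ha =>
        ih (d + (e + 1)) j d (e + 1) (by omega) rfl _ ha
          ((hf.slice (by omega) k a).mono (by omega) le_rfl)
      have := hall 0 h0
      have := hall 1 h1
      have := hall 2 h2
      have e2 : 3 ^ (d + 1) * 2 ^ e * 2 = 3 * (3 ^ d * 2 ^ (e + 1)) := by ring
      linarith

/-! ### Neighbourhoods in the Hamming graph -/

theorem hammingDist_eq_one_iff {ι α : Type*} [Fintype ι] [DecidableEq ι] [DecidableEq α]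
    {x y : ι → α} :
    hammingDist x y = 1 ↔ ∃ k a, a ≠ x k ∧ y = Function.update x k a := by
  constructor
  · intro h
    obtain ⟨k, hk⟩ := Finset.card_eq_one.1 h
    have hk' : ∀ l, x l ≠ y l ↔ l = k := fun l => by
      simpa using Finset.ext_iff.1 hk l
    refine ⟨k, y k, ((hk' k).2 rfl).symm, funext fun l => ?_⟩
    by_cases hl : l = k
    · subst hl; simp
    · rw [Function.update_of_ne hl]
      exact (not_not.1 fun h => hl ((hk' l).1 h)).symm
  · rintro ⟨k, a, ha, rfl⟩
    refine Finset.card_eq_one.2 ⟨k, Finset.ext fun l => ?_⟩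
    by_cases hl : l = k
    · subst hl; simpa using ha.symm
    · simp [hl]

theorem hammingDist_le_one_of_forall_ne {ι α : Type*} [Fintype ι] [DecidableEq α]
    {x y : ι → α} (k : ι) (h : ∀ l, l ≠ k → x l = y l) : hammingDist x y ≤ 1 := by
  refine (Finset.card_le_card (t := {k}) fun l hl => ?_).trans_eq (Finset.card_singleton k)
  simp only [Finset.mem_filter, Finset.mem_univ, true_and] at hl
  exact Finset.mem_singleton.2 (not_not.1 fun hlk => hl (h l hlk))

theorem mem_closedNeighborhood_hammingGraph {n q : ℕ} {x y : Fin n → Fin q} :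
    y ∈ closedNeighborhood (hammingGraph n q) x ↔ hammingDist x y ≤ 1 := by
  have h1 : y ∈ closedNeighborhood (hammingGraph n q) x ↔ hammingDist x y = 1 ∨ y = x := Iff.rfl
  rw [h1, Nat.le_one_iff_eq_zero_or_eq_one, hammingDist_eq_zero, or_comm, eq_comm]

theorem lineSum_eq {n q : ℕ} (f : (Fin n → Fin q) → ℚ) (x : Fin n → Fin q) :
    lineSum f x = (n - 1) * f x +
      ∑ y ∈ Finset.univ.filter (fun y => hammingDist x y ≤ 1), f y := by
  have h1 : Finset.univ.filter (fun y => hammingDist x y ≤ 1) =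
      insert x ((Finset.univ.filter fun s : Fin n × Fin q => s.2 ≠ x s.1).image
        fun s => Function.update x s.1 s.2) := by
    ext y
    simp only [Nat.le_one_iff_eq_zero_or_eq_one, hammingDist_eq_zero, hammingDist_eq_one_iff,
      Finset.mem_filter, Finset.mem_univ, true_and, Finset.mem_insert, Finset.mem_image,
      Prod.exists, eq_comm (a := y)]
  have h2 : x ∉ (Finset.univ.filter fun s : Fin n × Fin q => s.2 ≠ x s.1).image
      fun s => Function.update x s.1 s.2 := by
    simp only [Finset.mem_image, Finset.mem_filter, Finset.mem_univ, true_and, not_exists, not_and]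
    intro s hs h
    exact hs (by simpa using congrFun h s.1)
  rw [h1, Finset.sum_insert h2, Finset.sum_image]
  · have h3 : ∑ s : Fin n × Fin q, f (Function.update x s.1 s.2) = lineSum f x :=
      Fintype.sum_prod_type _
    rw [← h3, ← Finset.sum_filter_add_sum_filter_not Finset.univ
      (fun s : Fin n × Fin q => s.2 ≠ x s.1)]
    have h4 : ∑ s ∈ Finset.univ.filter (fun s : Fin n × Fin q => ¬ s.2 ≠ x s.1),
        f (Function.update x s.1 s.2) = n * f x := by
      rw [Finset.sum_congr rfl (g := fun _ => f x), Finset.sum_const]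
      · have : (Finset.univ.filter fun s : Fin n × Fin q => ¬ s.2 ≠ x s.1) =
            Finset.univ.map ⟨fun k : Fin n => (k, x k), fun k l h => (Prod.ext_iff.1 h).1⟩ := by
          ext ⟨k, a⟩
          simp only [Finset.mem_filter, Finset.mem_univ, true_and, not_not, Finset.mem_map]
          constructor
          · rintro rfl
            exact ⟨k, rfl⟩
          · rintro ⟨l, hl⟩
            obtain ⟨rfl, rfl⟩ := Prod.ext_iff.1 hl
            rfl
        rw [this, Finset.card_map, Finset.card_univ, Fintype.card_fin, nsmul_eq_mul]
      · rintro ⟨k, a⟩ h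
        simp only [Finset.mem_filter, Finset.mem_univ, true_and, not_not] at h
        rw [h, Function.update_eq_self]
    rw [h4]; ring
  · rintro ⟨k, a⟩ hk ⟨l, b⟩ hl h
    simp only [Finset.coe_filter, Finset.mem_univ, true_and, Set.mem_ofPred_eq] at hk hl h
    have hkl : k = l := by
      by_contra hne
      have := congrFun h k
      rw [Function.update_self, Function.update_of_ne hne] at this
      exact hk this
    subst hkl
    have := congrFun h k
    rw [Function.update_self, Function.update_self] at this
    rw [this]

/-! ### Bitrades as eigenfunctions -/

open scoped Classical in
/-- The difference of the indicator functions of two sets. -/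
noncomputable def bitradeFunction {α : Type*} (T₀ T₁ : Set α) : α → ℚ :=
  fun x => (if x ∈ T₀ then 1 else 0) - (if x ∈ T₁ then 1 else 0)

section
variable {n q : ℕ} {T₀ T₁ : Set (Fin n → Fin q)}

theorem supportCard_bitradeFunction (h : Disjoint T₀ T₁) :
    supportCard (bitradeFunction T₀ T₁) = T₀.ncard + T₁.ncard := by
  classical
  rw [← Set.ncard_union_eq h, Set.ncard_eq_toFinset_card', supportCard]
  congr 1
  ext x
  have : x ∈ T₀ → x ∉ T₁ := fun hx => Set.disjoint_left.1 h hx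
  rw [Finset.mem_filter, Set.mem_toFinset, Set.mem_union, bitradeFunction]
  by_cases h0 : x ∈ T₀ <;> by_cases h1 : x ∈ T₁ <;> simp_all

/-- Summing over closed neighbourhoods kills the signed indicator function of a bitrade. -/
theorem lineSum_bitradeFunction (h : IsOnePerfectBitrade (hammingGraph n q) T₀ T₁) :
    lineSum (bitradeFunction T₀ T₁) = ((n : ℚ) - 1) • bitradeFunction T₀ T₁ := by
  classical
  funext x
  have hcard : ∀ T : Set (Fin n → Fin q),
      (((Finset.univ.filter fun y => hammingDist x y ≤ 1).filter (· ∈ T)).card) =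
        (closedNeighborhood (hammingGraph n q) x ∩ T).ncard := by
    intro T
    rw [Set.ncard_eq_toFinset_card']
    congr 1
    ext y
    simp [mem_closedNeighborhood_hammingGraph]
  rw [lineSum_eq, Pi.smul_apply, smul_eq_mul, add_eq_left]
  simp only [bitradeFunction]
  rw [Finset.sum_sub_distrib, Finset.sum_boole, Finset.sum_boole, hcard, hcard]
  rcases h.neighborhood x with ⟨h0, h1⟩ | h0
  · rw [h0, h1, sub_self]
  · rw [Set.inter_union_distrib_left, Set.union_empty_iff] at h0
    rw [h0.1, h0.2, sub_self]

theorem bitradeFunction_ne_zero (h : IsOnePerfectBitrade (hammingGraph n q) T₀ T₁) :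
    bitradeFunction T₀ T₁ ≠ 0 := by
  obtain ⟨x, hx⟩ := h.nonempty_left
  have hx' := Set.disjoint_left.1 h.disjoint hx
  refine Function.ne_iff.2 ⟨x, ?_⟩
  simp [bitradeFunction, hx, hx']

/-- The eigenvalue of `lineSum` on the signed indicator function is `n - 1`, hence a multiple of `q`.
-/
theorem exists_length_eq_of_bitrade (h : IsOnePerfectBitrade (hammingGraph n q) T₀ T₁) :
    ∃ m, n = q * m + 1 := by
  obtain ⟨m, -, hm⟩ :=
    exists_eq_of_lineSum_eq (bitradeFunction_ne_zero h) (lineSum_bitradeFunction h)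
  refine ⟨m, ?_⟩
  have : (n : ℚ) = q * m + 1 := by linarith
  exact_mod_cast this

end

/-- With `q = p + 1` and `n = qm + 1`, the eigenvalue `-1` of `H(n,q)` has index `pm + 1`. -/
theorem inBand_bitradeFunction {p m : ℕ} {T₀ T₁ : Set (Fin ((p + 1) * m + 1) → Fin (p + 1))}
    (h : IsOnePerfectBitrade (hammingGraph ((p + 1) * m + 1) (p + 1)) T₀ T₁) :
    InBand ((p + 1) * m + 1) (p * m + 1 : ℕ) (p * m + 1 : ℕ) (bitradeFunction T₀ T₁) := by
  refine InBand.of_lineSum_eq (by omega) ?_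
  rw [lineSum_bitradeFunction h]
  congr 1
  push_cast
  ring

theorem bitrade_card_ge {p m : ℕ} (hp : 3 ≤ p)
    {T₀ T₁ : Set (Fin ((p + 1) * m + 1) → Fin (p + 1))}
    (h : IsOnePerfectBitrade (hammingGraph ((p + 1) * m + 1) (p + 1)) T₀ T₁) :
    2 ^ (p * m + 1) * p ^ m ≤ T₀.ncard + T₁.ncard := by
  rw [← supportCard_bitradeFunction h.disjoint]
  have hle : m ≤ p * m := Nat.le_mul_of_pos_left m (by omega)
  have h1 := supportCard_ge_of_le_add hp _ (p * m + 1) (p * m + 1) m (p * m + 1 - m) (by ring)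
    (by omega) _ (bitradeFunction_ne_zero h) (inBand_bitradeFunction h)
  rwa [show m + (p * m + 1 - m) = p * m + 1 by omega] at h1

theorem bitrade_card_ge_three {m : ℕ} {T₀ T₁ : Set (Fin (3 * m + 1) → Fin 3)}
    (h : IsOnePerfectBitrade (hammingGraph (3 * m + 1) 3) T₀ T₁) :
    2 ^ (m + 1) * 3 ^ m ≤ T₀.ncard + T₁.ncard := by
  rw [← supportCard_bitradeFunction h.disjoint, mul_comm]
  exact supportCard_ge_of_le_add_three _ (2 * m + 1) (2 * m + 1) m (m + 1) (by ring)
    (by ring) _ (bitradeFunction_ne_zero h) (inBand_bitradeFunction (p := 2) h)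

/-! ### Permutations as words -/

/-- The words of length `q` that list a permutation of sign `s` of the alphabet. -/
def permWords (q : ℕ) (s : ℤˣ) : Set (Fin q → Fin q) :=
  {u | ∃ σ : Equiv.Perm (Fin q), Equiv.Perm.sign σ = s ∧ ⇑σ = u}

theorem eq_of_bijective_of_forall_ne {α : Type*} {u w : α → α} (hu : u.Bijective)
    (hw : w.Bijective) (k : α) (h : ∀ l, l ≠ k → u l = w l) : u = w := by
  classical
  funext l
  by_cases hl : l = k
  · subst hl
    obtain ⟨j, hj⟩ := hw.2 (u l)
    by_cases hjl : j = l
    · rw [← hj, hjl]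
    · rw [← h j hjl] at hj
      exact absurd (hu.1 hj) hjl
  · exact h l hl

theorem bijective_of_mem_permWords {q : ℕ} {s : ℤˣ} {u : Fin q → Fin q}
    (hu : u ∈ permWords q s) : u.Bijective := by
  obtain ⟨σ, -, rfl⟩ := hu
  exact σ.bijective

theorem eq_of_hammingDist_le_one_of_bijective {q : ℕ} {u w : Fin q → Fin q} (hu : u.Bijective)
    (hw : w.Bijective) (h : hammingDist u w ≤ 1) : u = w := by
  rcases Nat.le_one_iff_eq_zero_or_eq_one.1 h with h | h
  · exact hammingDist_eq_zero.1 h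
  · obtain ⟨k, a, -, rfl⟩ := hammingDist_eq_one_iff.1 h
    exact eq_of_bijective_of_forall_ne hu hw k fun l hl => (Function.update_of_ne hl _ _).symm

theorem disjoint_permWords {q : ℕ} {u : Fin q → Fin q} (h : u ∈ permWords q 1) :
    u ∉ permWords q (-1) := by
  rintro ⟨τ, hτ, hτu⟩
  obtain ⟨σ, hσ, hσu⟩ := h
  obtain rfl : τ = σ := DFunLike.coe_injective (hτu.trans hσu.symm)
  rw [hσ] at hτ
  exact absurd hτ (by decide)

/-- A word that is not a permutation but is adjacent to one repeats exactly one letter; it is then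
adjacent to exactly two permutations, which differ by a transposition. -/
theorem existsUnique_permWords_of_not_bijective {q : ℕ} {s : ℤˣ} {u w : Fin q → Fin q}
    (hu : ¬ u.Bijective) (hw : w ∈ permWords q s) (h : hammingDist u w ≤ 1) :
    (∃! y, hammingDist u y ≤ 1 ∧ y ∈ permWords q s) ∧
      ∃! y, hammingDist u y ≤ 1 ∧ y ∈ permWords q (-s) := by
  obtain ⟨σ, hσ, rfl⟩ := hw
  have hne : hammingDist (⇑σ) u = 1 := by
    rw [hammingDist_comm]
    refine (Nat.le_one_iff_eq_zero_or_eq_one.1 h).resolve_left fun h0 => hu ?_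
    rw [hammingDist_eq_zero.1 h0]
    exact σ.bijective
  obtain ⟨k, a, ha, hua⟩ := hammingDist_eq_one_iff.1 hne
  set l := σ.symm a with hl
  have hσl : σ l = a := σ.apply_symm_apply a
  have hkl : l ≠ k := fun h => ha (by rw [← hσl, h])
  have huk : u k = a := by rw [hua, Function.update_self]
  have huσ : ∀ j, j ≠ k → u j = σ j := fun j hj => by rw [hua, Function.update_of_ne hj]
  set τ : Equiv.Perm (Fin q) := σ * Equiv.swap k l with hτ
  have hsign : Equiv.Perm.sign τ = -s := by
    rw [hτ, Equiv.Perm.sign_mul, hσ, Equiv.Perm.sign_swap hkl.symm, mul_neg_one]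
  have huτ : ∀ j, j ≠ l → u j = τ j := fun j hj => by
    by_cases hjk : j = k
    · rw [hjk, huk, hτ, Equiv.Perm.mul_apply, Equiv.swap_apply_left, hσl]
    · rw [huσ j hjk, hτ, Equiv.Perm.mul_apply, Equiv.swap_apply_of_ne_of_ne hjk hj]
  have hor : ∀ y : Fin q → Fin q, hammingDist u y ≤ 1 → y.Bijective → y = σ ∨ y = τ := by
    intro y hy hyb
    rcases Nat.le_one_iff_eq_zero_or_eq_one.1 hy with h0 | h1
    · exact absurd hyb (hammingDist_eq_zero.1 h0 ▸ hu)
    obtain ⟨j, b, -, rfl⟩ := hammingDist_eq_one_iff.1 h1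
    by_cases hjk : j = k
    · refine Or.inl (eq_of_bijective_of_forall_ne hyb σ.bijective k fun i hi => ?_)
      rw [hjk, Function.update_of_ne hi, huσ i hi]
    by_cases hjl : j = l
    · refine Or.inr (eq_of_bijective_of_forall_ne hyb τ.bijective l fun i hi => ?_)
      rw [hjl, Function.update_of_ne hi, huτ i hi]
    · refine absurd (hyb.1 (a₁ := k) (a₂ := l) ?_) hkl.symm
      rw [Function.update_of_ne (Ne.symm hjk), Function.update_of_ne (Ne.symm hjl), huk,
        huσ l hkl, hσl]
  have hs : s ≠ -s := by
    rcases Int.units_eq_one_or s with rfl | rfl <;> decide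
  refine ⟨⟨σ, ⟨h, σ, hσ, rfl⟩, ?_⟩, ⟨τ, ⟨hammingDist_le_one_of_forall_ne l huτ, τ, hsign, rfl⟩, ?_⟩⟩
  · rintro y ⟨hy, hys⟩
    refine (hor y hy (bijective_of_mem_permWords hys)).resolve_right fun hyτ => ?_
    obtain ⟨ρ, hρ, rfl⟩ := hys
    obtain rfl : ρ = τ := DFunLike.coe_injective hyτ
    exact hs (hρ.symm.trans hsign)
  · rintro y ⟨hy, hys⟩
    refine (hor y hy (bijective_of_mem_permWords hys)).resolve_left fun hyσ => ?_
    obtain ⟨ρ, hρ, rfl⟩ := hys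
    obtain rfl : ρ = σ := DFunLike.coe_injective hyσ
    exact hs (hσ.symm.trans hρ)

theorem permWords_union (q : ℕ) :
    permWords q 1 ∪ permWords q (-1) = Set.range fun σ : Equiv.Perm (Fin q) => ⇑σ := by
  ext u
  constructor
  · rintro (⟨σ, -, rfl⟩ | ⟨σ, -, rfl⟩) <;> exact ⟨σ, rfl⟩
  · rintro ⟨σ, rfl⟩
    exact (Int.units_eq_one_or (Equiv.Perm.sign σ)).imp (fun h => ⟨σ, h, rfl⟩) fun h => ⟨σ, h, rfl⟩

theorem ncard_permWords_union (q : ℕ) :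
    (permWords q 1 ∪ permWords q (-1)).ncard = q.factorial := by
  rw [permWords_union, ← Set.image_univ, Set.ncard_image_of_injective _ DFunLike.coe_injective,
    Set.ncard_univ, Nat.card_perm, Nat.card_fin]

/-! ### Construction of small bitrades -/

theorem isOnePerfectBitrade_neighborhood_iff {n q : ℕ} {T₀ T₁ : Set (Fin n → Fin q)}
    {x : Fin n → Fin q} :
    (((closedNeighborhood (hammingGraph n q) x ∩ T₀).ncard = 1 ∧
        (closedNeighborhood (hammingGraph n q) x ∩ T₁).ncard = 1) ∨
      closedNeighborhood (hammingGraph n q) x ∩ (T₀ ∪ T₁) = ∅) ↔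
    (((∃! y, hammingDist x y ≤ 1 ∧ y ∈ T₀) ∧ ∃! y, hammingDist x y ≤ 1 ∧ y ∈ T₁) ∨
      ∀ y, hammingDist x y ≤ 1 → y ∉ T₀ ∧ y ∉ T₁) := by
  have h1 : ∀ T : Set (Fin n → Fin q), (closedNeighborhood (hammingGraph n q) x ∩ T).ncard = 1 ↔
      ∃! y, hammingDist x y ≤ 1 ∧ y ∈ T := by
    intro T
    rw [Set.ncard_eq_one]
    simp only [Set.eq_singleton_iff_unique_mem, Set.mem_inter_iff,
      mem_closedNeighborhood_hammingGraph, ExistsUnique]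
  rw [h1, h1]
  refine or_congr Iff.rfl ?_
  simp only [Set.eq_empty_iff_forall_notMem, Set.mem_inter_iff, Set.mem_union,
    mem_closedNeighborhood_hammingGraph, not_and, not_or]

theorem hammingDist_append {n m : ℕ} {α : Type*} [DecidableEq α] (v v' : Fin n → α)
    (u u' : Fin m → α) :
    hammingDist (Fin.append v u) (Fin.append v' u') = hammingDist v v' + hammingDist u u' := by
  simp only [hammingDist, Finset.card_filter, Fin.sum_univ_add, Fin.append_left, Fin.append_right]

/-- The words `vu` with `v ∈ A`, `u ∈ E`, or `v ∈ B`, `u ∈ O`. -/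
def appendPairs {n m : ℕ} {α : Type*} (A B : Set (Fin n → α)) (E O : Set (Fin m → α)) :
    Set (Fin (n + m) → α) :=
  {z | ∃ v u, z = Fin.append v u ∧ ((v ∈ A ∧ u ∈ E) ∨ (v ∈ B ∧ u ∈ O))}

section
variable {n m : ℕ} {α : Type*} {A B : Set (Fin n → α)} {E O : Set (Fin m → α)}

theorem append_inj {v v' : Fin n → α} {u u' : Fin m → α} :
    Fin.append v u = Fin.append v' u' ↔ v = v' ∧ u = u' := by
  constructor
  · intro h
    refine ⟨funext fun i => ?_, funext fun i => ?_⟩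
    · simpa using congrFun h (Fin.castAdd m i)
    · simpa using congrFun h (Fin.natAdd n i)
  · rintro ⟨rfl, rfl⟩; rfl

theorem append_mem_appendPairs {v : Fin n → α} {u : Fin m → α} :
    Fin.append v u ∈ appendPairs A B E O ↔ (v ∈ A ∧ u ∈ E) ∨ (v ∈ B ∧ u ∈ O) := by
  constructor
  · rintro ⟨v', u', h, h'⟩
    obtain ⟨rfl, rfl⟩ := append_inj.1 h
    exact h'
  · exact fun h => ⟨v, u, rfl, h⟩

theorem appendPairs_swap : appendPairs A B E O = appendPairs B A O E := by
  ext z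
  simp only [appendPairs, Set.mem_ofPred_eq, or_comm]

theorem forall_append {P : (Fin (n + m) → α) → Prop} :
    (∀ z, P z) ↔ ∀ v u, P (Fin.append v u) :=
  ⟨fun h _ _ => h _, fun h z => by
    have := h (fun i => z (Fin.castAdd m i)) (fun i => z (Fin.natAdd n i))
    rwa [Fin.append_castAdd_natAdd] at this⟩

variable [DecidableEq α]

/-- If no two words of `E ∪ O` are adjacent, moving from `vu` with `u ∈ E` changes only `v`. -/
theorem existsUnique_appendPairs_of_right {v : Fin n → α} {u : Fin m → α} (huE : u ∈ E)
    (huO : u ∉ O) (hsep : ∀ w ∈ E ∪ O, hammingDist u w ≤ 1 → u = w)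
    (h : ∃! y, hammingDist v y ≤ 1 ∧ y ∈ A) :
    ∃! z, hammingDist (Fin.append v u) z ≤ 1 ∧ z ∈ appendPairs A B E O := by
  obtain ⟨y, ⟨hy, hyA⟩, huniq⟩ := h
  refine ⟨Fin.append y u, ⟨?_, append_mem_appendPairs.2 (Or.inl ⟨hyA, huE⟩)⟩, ?_⟩
  · rwa [hammingDist_append, hammingDist_self, add_zero]
  · rw [forall_append]
    rintro v' u' ⟨hd, hm⟩
    rw [hammingDist_append] at hd
    rw [append_mem_appendPairs] at hm
    obtain rfl := hsep u' (hm.imp And.right And.right) (by omega)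
    have hv' : v' ∈ A := by tauto
    rw [huniq v' ⟨by omega, hv'⟩]

/-- If `u ∉ E ∪ O`, moving from `vu` into `appendPairs A B E O` changes only `u`. -/
theorem existsUnique_appendPairs_of_left {v : Fin n → α} {u : Fin m → α} (hvA : v ∈ A)
    (hvB : v ∉ B) (hu : u ∉ E ∪ O) (h : ∃! w, hammingDist u w ≤ 1 ∧ w ∈ E) :
    ∃! z, hammingDist (Fin.append v u) z ≤ 1 ∧ z ∈ appendPairs A B E O := by
  obtain ⟨w, ⟨hw, hwE⟩, huniq⟩ := h
  refine ⟨Fin.append v w, ⟨?_, append_mem_appendPairs.2 (Or.inl ⟨hvA, hwE⟩)⟩, ?_⟩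
  · rwa [hammingDist_append, hammingDist_self, zero_add]
  · rw [forall_append]
    rintro v' u' ⟨hd, hm⟩
    rw [hammingDist_append] at hd
    rw [append_mem_appendPairs] at hm
    have hne : hammingDist u u' ≠ 0 := fun h0 => by
      rw [hammingDist_eq_zero.1 h0] at hu
      exact hu (hm.imp And.right And.right)
    obtain rfl : v = v' := hammingDist_eq_zero.1 (by omega)
    have hu' : u' ∈ E := by tauto
    rw [huniq u' ⟨by omega, hu'⟩]

end

/-- Appending the even permutations to the words of a bitrade, and the odd ones to the words of the
same bitrade with its parts exchanged, gives a bitrade. -/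
theorem IsOnePerfectBitrade.append {n q : ℕ} {T₀ T₁ : Set (Fin n → Fin q)}
    (h : IsOnePerfectBitrade (hammingGraph n q) T₀ T₁) :
    IsOnePerfectBitrade (hammingGraph (n + q) q)
      (appendPairs T₀ T₁ (permWords q 1) (permWords q (-1)))
      (appendPairs T₁ T₀ (permWords q 1) (permWords q (-1))) := by
  have hdisj : ∀ {v}, v ∈ T₀ → v ∉ T₁ := fun hv => Set.disjoint_left.1 h.disjoint hv
  have hone : ⇑(1 : Equiv.Perm (Fin q)) ∈ permWords q 1 := ⟨1, by simp, rfl⟩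
  have hsep : ∀ {u : Fin q → Fin q} {s}, u ∈ permWords q s →
      ∀ w ∈ permWords q 1 ∪ permWords q (-1), hammingDist u w ≤ 1 → u = w :=
    fun hu w hw hd => eq_of_hammingDist_le_one_of_bijective (bijective_of_mem_permWords hu)
      (hw.elim bijective_of_mem_permWords bijective_of_mem_permWords) hd
  refine ⟨Set.disjoint_left.2 ?_, ?_, ?_, ?_⟩
  · rw [forall_append]
    intro v u h0 h1
    rw [append_mem_appendPairs] at h0 h1
    have h2 := @hdisj v
    have h3 := disjoint_permWords (u := u)
    tauto
  · obtain ⟨v, hv⟩ := h.nonempty_left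
    exact ⟨_, append_mem_appendPairs.2 (Or.inl ⟨hv, hone⟩)⟩
  · obtain ⟨v, hv⟩ := h.nonempty_right
    exact ⟨_, append_mem_appendPairs.2 (Or.inl ⟨hv, hone⟩)⟩
  · rw [forall_append]
    intro v u
    rw [isOnePerfectBitrade_neighborhood_iff]
    by_cases hu : u ∈ permWords q 1 ∪ permWords q (-1)
    · rcases isOnePerfectBitrade_neighborhood_iff.1 (h.neighborhood v) with ⟨h0, h1⟩ | h0
      · left
        rcases hu with hu | hu
        · exact ⟨existsUnique_appendPairs_of_right hu (disjoint_permWords hu) (hsep hu) h0,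
            existsUnique_appendPairs_of_right hu (disjoint_permWords hu) (hsep hu) h1⟩
        · have hu' : u ∉ permWords q 1 := fun h => disjoint_permWords h hu
          rw [appendPairs_swap, appendPairs_swap (A := T₁) (E := permWords q 1)]
          rw [Set.union_comm] at hsep
          exact ⟨existsUnique_appendPairs_of_right hu hu' (hsep hu) h1,
            existsUnique_appendPairs_of_right hu hu' (hsep hu) h0⟩
      · right
        rw [forall_append]
        intro v' u' hd
        rw [hammingDist_append] at hd
        have := h0 v' (by omega)
        rw [append_mem_appendPairs, append_mem_appendPairs]
        tauto
    · have hub : ¬ u.Bijective := fun hb => hu (by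
        rw [permWords_union]; exact ⟨Equiv.ofBijective u hb, rfl⟩)
      have hsp : (∃ w ∈ permWords q 1 ∪ permWords q (-1), hammingDist u w ≤ 1) →
          (∃! y, hammingDist u y ≤ 1 ∧ y ∈ permWords q 1) ∧
            ∃! y, hammingDist u y ≤ 1 ∧ y ∈ permWords q (-1) := by
        rintro ⟨w, hw | hw, hd⟩
        · exact existsUnique_permWords_of_not_bijective hub hw hd
        · have := existsUnique_permWords_of_not_bijective hub hw hd
          rw [neg_neg] at this
          exact this.symm
      by_cases hw : (∃ w ∈ permWords q 1 ∪ permWords q (-1), hammingDist u w ≤ 1) ∧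
          (v ∈ T₀ ∨ v ∈ T₁)
      · left
        obtain ⟨hE, hO⟩ := hsp hw.1
        have hu' := hu
        rw [Set.union_comm] at hu'
        rcases hw.2 with hv | hv
        · refine ⟨existsUnique_appendPairs_of_left hv (hdisj hv) hu hE, ?_⟩
          rw [appendPairs_swap]
          exact existsUnique_appendPairs_of_left hv (hdisj hv) hu' hO
        · have hv' : v ∉ T₀ := fun h => hdisj h hv
          refine ⟨?_, existsUnique_appendPairs_of_left hv hv' hu hE⟩
          rw [appendPairs_swap]
          exact existsUnique_appendPairs_of_left hv hv' hu' hO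
      · right
        rw [forall_append]
        intro v' u' hd
        rw [hammingDist_append] at hd
        rw [append_mem_appendPairs, append_mem_appendPairs]
        by_contra hmem
        have hu'mem : u' ∈ permWords q 1 ∪ permWords q (-1) := by
          simp only [Set.mem_union]; tauto
        have hne : hammingDist u u' ≠ 0 := fun h0 => by
          rw [hammingDist_eq_zero.1 h0] at hu
          exact hu hu'mem
        obtain rfl : v = v' := hammingDist_eq_zero.1 (by omega)
        exact hw ⟨⟨u', hu'mem, by omega⟩, by tauto⟩

theorem ncard_appendPairs_union {n m : ℕ} {α : Type*} [Finite α] (A B : Set (Fin n → α))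
    (E O : Set (Fin m → α)) :
    (appendPairs A B E O ∪ appendPairs B A E O).ncard = (A ∪ B).ncard * (E ∪ O).ncard := by
  have h : appendPairs A B E O ∪ appendPairs B A E O =
      (fun s : (Fin n → α) × (Fin m → α) => Fin.append s.1 s.2) '' ((A ∪ B) ×ˢ (E ∪ O)) := by
    refine Set.ext (forall_append.2 fun v u => ?_)
    rw [Set.mem_union, append_mem_appendPairs, append_mem_appendPairs]
    constructor
    · intro h
      exact ⟨(v, u), ⟨by simp only [Set.mem_union]; tauto, by simp only [Set.mem_union]; tauto⟩,
        rfl⟩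
    · rintro ⟨⟨v', u'⟩, ⟨hv, hu⟩, h⟩
      obtain ⟨rfl, rfl⟩ := append_inj.1 h
      simp only [Set.mem_union] at hv hu
      tauto
  rw [h, Set.ncard_image_of_injective _ fun s t hst => Prod.ext_iff.2 (append_inj.1 hst),
    Set.ncard_prod]

theorem two_mem_bitradeSizes_one {q : ℕ} (hq : 2 ≤ q) : 2 ∈ bitradeSizes 1 q := by
  have hd : ∀ x y : Fin 1 → Fin q, hammingDist x y ≤ 1 := fun x y => by
    simpa using hammingDist_le_card_fintype (x := x) (y := y)
  refine ⟨{fun _ => ⟨0, by omega⟩}, {fun _ => ⟨1, by omega⟩}, ⟨?_, by simp, by simp, ?_⟩, by simp⟩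
  · rw [Set.disjoint_singleton]
    exact fun h => by simpa using congrFun h 0
  · intro x
    exact isOnePerfectBitrade_neighborhood_iff.2 (Or.inl ⟨by simp [hd], by simp [hd]⟩)

theorem two_mul_factorial_pow_mem_bitradeSizes {q : ℕ} (hq : 2 ≤ q) (m : ℕ) :
    2 * q.factorial ^ m ∈ bitradeSizes (q * m + 1) q := by
  induction m with
  | zero => simpa using two_mem_bitradeSizes_one hq
  | succ m ih =>
    obtain ⟨T₀, T₁, h, hcard⟩ := ih
    rw [show q * (m + 1) + 1 = q * m + 1 + q by ring]
    refine ⟨_, _, h.append, ?_⟩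
    rw [← Set.ncard_union_eq h.append.disjoint, ncard_appendPairs_union,
      Set.ncard_union_eq h.disjoint, hcard, ncard_permWords_union]
    ring

theorem mainTheorem3 :
    -- a bitrade in `H(n,q)` can exist only if `n = q * m + 1`
    (∀ n q : ℕ, 2 ≤ q → (bitradeSizes n q).Nonempty → ∃ m : ℕ, n = q * m + 1) ∧
    -- lower bound for `q ≥ 4`
    (∀ q m : ℕ, 4 ≤ q → ∀ T₀ T₁ : Set (Fin (q * m + 1) → Fin q),
      IsOnePerfectBitrade (hammingGraph (q * m + 1) q) T₀ T₁ →
        2 ^ ((q - 1) * m + 1) * (q - 1) ^ m ≤ T₀.ncard + T₁.ncard) ∧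
    -- lower bound for `q = 3`
    (∀ m : ℕ, ∀ T₀ T₁ : Set (Fin (3 * m + 1) → Fin 3),
      IsOnePerfectBitrade (hammingGraph (3 * m + 1) 3) T₀ T₁ →
        2 ^ (m + 1) * 3 ^ m ≤ T₀.ncard + T₁.ncard) ∧
    -- existence of bitrades of size `2 * (q!)^m`
    (∀ q m : ℕ, 2 ≤ q → 2 * q.factorial ^ m ∈ bitradeSizes (q * m + 1) q) ∧
    -- the minimum size for `q = 4` and `q = 3`
    (∀ m : ℕ, IsLeast (bitradeSizes (4 * m + 1) 4) (2 * 24 ^ m)) ∧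
    (∀ m : ℕ, IsLeast (bitradeSizes (3 * m + 1) 3) (2 * 6 ^ m)) := by
  have four : ∀ q m : ℕ, 4 ≤ q → ∀ T₀ T₁ : Set (Fin (q * m + 1) → Fin q),
      IsOnePerfectBitrade (hammingGraph (q * m + 1) q) T₀ T₁ →
        2 ^ ((q - 1) * m + 1) * (q - 1) ^ m ≤ T₀.ncard + T₁.ncard := by
    intro q m hq T₀ T₁ h
    obtain ⟨p, rfl⟩ := Nat.exists_eq_add_of_le' (show 1 ≤ q by omega)
    exact bitrade_card_ge (by omega) h
  refine ⟨?_, four, fun m T₀ T₁ h => bitrade_card_ge_three h,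
    fun q m hq => two_mul_factorial_pow_mem_bitradeSizes hq m, fun m => ⟨?_, ?_⟩,
    fun m => ⟨?_, ?_⟩⟩
  · rintro n q - ⟨_, T₀, T₁, h, -⟩
    exact exists_length_eq_of_bitrade h
  · exact two_mul_factorial_pow_mem_bitradeSizes (q := 4) (by norm_num) m
  · rintro _ ⟨T₀, T₁, h, rfl⟩
    refine (four 4 m le_rfl T₀ T₁ h).trans' (le_of_eq ?_)
    rw [show 24 = 2 ^ 3 * 3 by norm_num, mul_pow, ← pow_mul]
    ring
  · exact two_mul_factorial_pow_mem_bitradeSizes (q := 3) (by norm_num) m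
  · rintro _ ⟨T₀, T₁, h, rfl⟩
    refine (bitrade_card_ge_three h).trans' (le_of_eq ?_)
    rw [show 6 = 2 * 3 by norm_num, mul_pow]
    ring
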